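/- **Setting.** A state-space topology is a pair $\langle\mathcal T,h\rangle$ of a search task $\mathcal T=\langle\mathcal S,s_{\mathcal I},\Delta,\Gamma\rangle$ (finite state set $\mathcal S$, initial state, successor sets $\Delta(s)\subseteq\mathcal S$, goal test $\Gamma$) and a heuristic $h:\mathcal S\to\mathbb Z^{\ge 0}\cup\{\infty\}$ such that no goal is reachable from $s$ whenever $h(s)=\infty$. A state from which no goal is reachable is a dead end. The topology is *EHC-complete* if there are no dead ends, or if all dead ends are recognized ($s$ is a dead end if and only if $h(s)=\infty$). The uninformative heuristic region (UHR) around $s$ is the set of states reachable from $s$ along paths on which $h\ge h(s)$ throughout. An exit of it is a state of the UHR that has a successor $t$ with $\Gamma(t)$ or $h(t)<h(s)$ (an escape state). The exit distance of the UHR is the length of a shortest path from $s$ to an exit. Let $D$ be the maximum exit distance over the UHRs around all states $s$ that are neither goals nor recognized dead ends, and let $B=\max_s|\Delta(s)|$. Enforced hill-climbing with restarting random walks repeats the following from $s=s_{\mathcal I}$ until a goal is reached: test $s$; then perform independent unbiased (uniform) random walks from $s$, testing each sampled state, where a walk ends when it samples a state $t$ with $\Gamma(t)$ or $h(t)<h(s)$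 (success, and $t$ becomes the new $s$), when it is in a state without successors, or when it reaches its depth limit. In EHC-RRW$^C_\ell$ the limit is always $\ell$. In EHC-RRW$^{\mathcal L}$ the $i$-th walk of every search has as its limit the $i$-th value of the Luby sequence $1,1,2,1,1,2,4,\dots$. The runtime is the number of goal tests performed ($\infty$ if the algorithm never stops). Everything below holds whether random walks expand recognized dead ends or treat them as states without successors. **Theorem.** There is a universal constant $C$ with the following properties. 1. Let $\langle\mathcal T,h\rangle$ be EHC-complete with $h(s_{\mathcal I})<\infty$. Then $D$ is finite. EHC-RRW$^C_\ell$ has finite expected runtime for every $\ell\ge D+1$, and EHC-RRW$^{\mathcal L}$ always has finite expected runtime. If $s_{\mathcal I}$ is not a goal, the expected runtime of EHC-RRW$^C_\ell$ with $\ell\ge D+1$ is at most $$C\,\max(h(s_{\mathcal I}),1)\;\ell\;B^{D+1},$$ and the expected runtime of EHC-RRW$^{\mathcal L}$ exceeds this guarantee for $\ell=D+1$ by at most a logarithmic factor: it is at most $$C\,\max(h(s_{\mathcal I}),1)\,(D+1)\,B^{D+1}\bigl(1+\log((D+1)B^{D+1})\bigr).$$ 2. Consider STRIPS problems with operator set $\mathcal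 O$, with the reachable fact sets as states, under the heuristic $h^+$ (the length of a shortest plan when delete effects are ignored). For every integer $D\ge 0$ there is a polynomial $p$ such that, for every domain (set of problems) in which every problem is EHC-complete for $h^+$ and has all its exit distances (of UHRs around states that are neither goals nor recognized dead ends) at most $D$, and for every problem of the domain with $h^+(s_{\mathcal I})<\infty$: the expected runtime of EHC-RRW$^C_\ell$ is at most $\ell\,p(|\mathcal O|)$ for all $\ell\ge D+1$, and that of EHC-RRW$^{\mathcal L}$ is at most $p(|\mathcal O|)$. If moreover $s_{\mathcal I}$ is not a goal, these expected runtimes are at most $C\,|\mathcal O|\,\ell\,|\mathcal O|^{D+1}$ and $C\,|\mathcal O|\,(D+1)\,|\mathcal O|^{D+1}\bigl(1+\log((D+1)|\mathcal O|^{D+1})\bigr)$ respectively. -/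

import Mathlib

open scoped ENNReal

universe u v

namespace EHCRRW

/-! ### Search tasks and state-space topologies -/

/-- A state-space search task over the state set `S`. -/
structure SearchTask (S : Type u) where
  /-- the initial state -/
  init : S
  /-- the state transition function: the set of successors of a state -/
  succ : S → Finset S
  /-- the goal test -/
  goal : S → Prop

namespace SearchTask

variable {S : Type u}

/-- There is a path from `s` to `t` with exactly `k` transitions. -/
def HasPath (T : SearchTask S) : ℕ → S → S → Prop
  | 0, s, t => s = t
  | k + 1, s, t => ∃ v ∈ T.succ s, T.HasPath k v t

/-- No goal state is reachable from `s`. -/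
def IsDeadEnd (T : SearchTask S) (s : S) : Prop :=
  ∀ k t, T.HasPath k s t → ¬ T.goal t

/-- A heuristic that never incorrectly identifies a state as a dead end. -/
def SafeHeuristic (T : SearchTask S) (h : S → ℕ∞) : Prop :=
  ∀ s, h s = ⊤ → T.IsDeadEnd s

/-- Either there are no dead ends, or the dead ends are recognized. -/
def EHCComplete (T : SearchTask S) (h : S → ℕ∞) : Prop :=
  (∀ s, ¬ T.IsDeadEnd s) ∨ (∀ s, T.IsDeadEnd s ↔ h s = ⊤)

/-- The goal test used while escaping the uninformative heuristic region around `s`. -/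
def uhrGoal (T : SearchTask S) (h : S → ℕ∞) (s t : S) : Prop :=
  T.goal t ∨ h t < h s

/-- The uninformative heuristic region around `s`: the states reachable from `s` along paths on
which no state has a heuristic value below `h s`. -/
def uhr (T : SearchTask S) (h : S → ℕ∞) (s : S) : Set S :=
  {v | Relation.ReflTransGen (fun a b => b ∈ T.succ a ∧ h s ≤ h b) s v}

/-- The exits of the region around `s`: the states in it with a successor that ends the search for
an escape (a successor with a smaller heuristic value, or a goal). -/
def IsExit (T : SearchTask S) (h : S → ℕ∞) (s v : S) : Prop :=
  v ∈ T.uhr h s ∧ ∃ w ∈ T.succ v, T.uhrGoal h s w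

/-- The exit distance of the region around `s`: the length of a shortest path from `s` to an exit
(`⊤` if there is none). -/
noncomputable def exitDist (T : SearchTask S) (h : S → ℕ∞) (s : S) : ℕ∞ :=
  ⨅ (k : ℕ) (_ : ∃ v, T.IsExit h s v ∧ T.HasPath k s v), (k : ℕ∞)

/-- The maximum exit distance over all regions that there can be a need to escape from, that is
around all states that are neither goals nor recognized dead ends. -/
noncomputable def maxExitDist (T : SearchTask S) (h : S → ℕ∞) : ℕ∞ :=
  ⨆ (s : S) (_ : ¬ T.goal s ∧ h s ≠ ⊤), T.exitDist h s

/-- The maximum number of successors of a state. -/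
def branching [Fintype S] (T : SearchTask S) : ℕ :=
  Finset.univ.sup fun s => (T.succ s).card

open Classical in
/-- The same task, with recognized dead ends treated as states without successors. -/
noncomputable def prune (T : SearchTask S) (h : S → ℕ∞) : SearchTask S where
  init := T.init
  succ s := if h s = ⊤ then ∅ else T.succ s
  goal := T.goal

end SearchTask

/-! ### Restarting random walks -/

open Classical in
/-- One unbiased random walk from a state, with at most the given number of steps. It stops when the
sampled successor passes the goal test, when the current state has no successors, or when the depth
limit is reached. The outcome is the state that passed the test (`none` if the walk failed) and the
number of states sampled, each of which is goal tested once. -/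
noncomputable def randomWalk {S : Type u} (succ : S → Finset S) (goal : S → Prop) :
    ℕ → S → PMF (Option S × ℕ)
  | 0, _ => PMF.pure (none, 0)
  | d + 1, s =>
    if hs : (succ s).Nonempty then
      (PMF.uniformOfFinset (succ s) hs).bind fun s' =>
        if goal s' then PMF.pure (some s', 1)
        else (randomWalk succ goal d s').map fun r => (r.1, r.2 + 1)
    else PMF.pure (none, 0)

/-- The Luby sequence `1, 1, 2, 1, 1, 2, 4, …`, indexed from `1`: the `i`-th value is `2 ^ k` if
`i = 2 ^ (k + 1) - 1`, and the `(i - 2 ^ k + 1)`-th value if `2 ^ k ≤ i < 2 ^ (k + 1) - 1`. The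
value at index `0` is not used. -/
def luby (i : ℕ) : ℕ :=
  if i = 0 then 0
  else if i + 1 = 2 ^ (Nat.log 2 i + 1) then 2 ^ Nat.log 2 i
  else luby (i - 2 ^ Nat.log 2 i + 1)
termination_by i
decreasing_by
  rename_i h0 h1
  have h2 : 2 ^ Nat.log 2 i ≤ i := Nat.pow_log_le_self 2 h0
  have h3 : i < 2 ^ (Nat.log 2 i + 1) := Nat.lt_pow_succ_log_self (by norm_num) i
  rcases Nat.eq_zero_or_pos (Nat.log 2 i) with hk | hk
  · rw [hk] at h1 h3
    omega
  · have h4 : 2 ^ 1 ≤ 2 ^ Nat.log 2 i := Nat.pow_le_pow_right (by norm_num) hk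
    omega

/-- The depth limits of constant-depth restarting random walks. -/
def constDepth (ℓ : ℕ) : ℕ → ℕ := fun _ => ℓ

/-- The depth limits of restarting random walks with the Luby policy (walks numbered from `0`). -/
def lubyDepth : ℕ → ℕ := fun i => luby (i + 1)

/-! ### Enforced hill-climbing with restarting random walks -/

/-- The control states of enforced hill-climbing with restarting random walks. -/
inductive Status (S : Type u) where
  /-- about to call the restarting random walk search from `s` -/
  | call (s : S)
  /-- in the search called from `s`, about to start walk number `i` (counted from `0`) from `s` -/
  | walk (s : S) (i : ℕ)
  /-- a solution was returned -/
  | halted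

namespace SearchTask

variable {S : Type u}

open Classical in
/-- After a search has returned a path that ends in `s`: stop if `s` is a goal, otherwise start the
next search from `s`. -/
noncomputable def next (T : SearchTask S) (s : S) : Status S :=
  if T.goal s then Status.halted else Status.call s

open Classical in
/-- One step of the algorithm: the new control state and the number of goal tests performed.
A call from `s` first tests `s` itself; a walk tests every sampled state; and when a search has
returned, the end of the path is tested against the goals of the task. -/
noncomputable def step (T : SearchTask S) (h : S → ℕ∞) (depth : ℕ → ℕ) :
    Status S → PMF (Status S × ℕ)
  | Status.halted => PMF.pure (Status.halted, 0)
  | Status.call s =>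
    if T.uhrGoal h s s then PMF.pure (T.next s, 2) else PMF.pure (Status.walk s 0, 1)
  | Status.walk s i =>
    (randomWalk T.succ (T.uhrGoal h s) (depth i) s).map fun r =>
      match r with
      | (none, k) => (Status.walk s (i + 1), k)
      | (some s', k) => (T.next s', k + 1)

/-- The joint law of the control state and the number of goal tests so far, after `n` steps of
enforced hill-climbing in which the `i`-th random walk of each search has depth limit `depth i`. -/
noncomputable def run (T : SearchTask S) (h : S → ℕ∞) (depth : ℕ → ℕ) : ℕ → PMF (Status S × ℕ)
  | 0 => PMF.pure (Status.call T.init, 0)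
  | n + 1 => (T.run h depth n).bind fun x =>
      (T.step h depth x.1).map fun y => (y.1, x.2 + y.2)

/-- The expected runtime in goal tests, the runtime being infinite on the runs that never stop:
the limit of the expected number of tests in the first `n` steps, plus infinity times the
probability of never stopping (with `⊤ * 0 = 0`). -/
noncomputable def expectedRuntime (T : SearchTask S) (h : S → ℕ∞) (depth : ℕ → ℕ) : ℝ≥0∞ :=
  (⨆ n, ∑' x : Status S × ℕ, T.run h depth n x * (x.2 : ℝ≥0∞)) +
    ⊤ * ⨅ n, (T.run h depth n).toOuterMeasure {x | x.1 ≠ Status.halted}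

end SearchTask

/-! ### STRIPS planning and the delete relaxation heuristic -/

/-- A STRIPS operator: preconditions, add effects and delete effects. -/
structure Operator (F : Type u) where
  pre : Finset F
  add : Finset F
  del : Finset F

/-- A STRIPS planning problem. -/
structure StripsProblem : Type (u + 1) where
  Fact : Type u
  [factFinite : Finite Fact]
  ops : Finset (Operator Fact)
  init : Finset Fact
  goal : Finset Fact

namespace StripsProblem

open Classical in
/-- `t` results from applying some applicable operator in `s`. -/
def Trans (P : StripsProblem.{u}) (s t : Finset P.Fact) : Prop :=
  ∃ o ∈ P.ops, o.pre ⊆ s ∧ t = (s \ o.del) ∪ o.add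

/-- The states of a problem: the sets of facts reachable from its initial state. -/
def State (P : StripsProblem.{u}) : Type u :=
  {s : Finset P.Fact // Relation.ReflTransGen P.Trans P.init s}

noncomputable instance (P : StripsProblem.{u}) : Fintype P.State :=
  haveI := P.factFinite
  @Fintype.ofFinite _ (inferInstanceAs (Finite (Subtype _)))

open Classical in
/-- The search task of a STRIPS problem. -/
noncomputable def task (P : StripsProblem.{u}) : SearchTask P.State where
  init := ⟨P.init, Relation.ReflTransGen.refl⟩
  succ s := Finset.univ.filter fun t => P.Trans s.1 t.1
  goal s := P.goal ⊆ s.1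

open Classical in
/-- The operator sequence is a plan from `s` when delete effects are ignored. -/
def IsRelaxedPlan (P : StripsProblem.{u}) : Finset P.Fact → List (Operator P.Fact) → Prop
  | s, [] => P.goal ⊆ s
  | s, o :: π => o ∈ P.ops ∧ o.pre ⊆ s ∧ P.IsRelaxedPlan (s ∪ o.add) π

/-- The heuristic `h⁺`: the length of a shortest delete-relaxed plan (`⊤` if there is none). -/
noncomputable def hPlus (P : StripsProblem.{u}) (s : P.State) : ℕ∞ :=
  ⨅ (π : List (Operator P.Fact)) (_ : P.IsRelaxedPlan s.1 π), (π.length : ℕ∞)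

end StripsProblem

/-- A domain (a set of problems) that is EHC-complete for `h⁺`, in all of whose problems all
uninformative heuristic regions have exit distance at most `D`. -/
def IsBoundedUHRDomain (𝒟 : Set StripsProblem.{u}) (D : ℕ) : Prop :=
  ∀ P ∈ 𝒟, P.task.EHCComplete P.hPlus ∧ P.task.maxExitDist P.hPlus ≤ D

end EHCRRW

open EHCRRW

/-! A state `s` that is neither a goal nor a recognized dead end has an escape state at the end of a
path with at most `D + 1` transitions: `D` to reach an exit, one more to leave. An unbiased walk
with limit at least `D + 1` follows that path, or succeeds earlier, with probability at least `1 /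
N`, where `N = B ^ (D + 1)` (`succeeded_le_expect`). With constant limit `ℓ` the number of walks per
search is dominated by a geometric variable of mean `N`, so a search costs `O(ℓ N)`. Each successful
search reaches a goal or lowers `h` strictly, so at most `h + 1` searches are needed. The potential
`(h s + 1) * W`, with `W` a bound for one search, turns this into a bound on the expected runtime;
charging one extra unit per step also shows that the run stops almost surely
(`expectedRuntime_le_of_potential`).

For the Luby limits, the first `2 ^ (m + 1) - 1` terms are two copies of the first `2 ^ m - 1`
followed by `2 ^ m`. Hence passing from `m` to `m + 1` at least squares the survival probability,
while the cost grows only like `(m + 1) * 2 ^ m`. Once survival is at most `1 / 2`, at a level `M`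
with `2 ^ M = O((D + 1) N)`, its doubly exponential decay beats this growth, and the total is `O(M *
2 ^ M)` (`lubyCost_failBound_le`).

Completeness and safety make `D` finite and preserve escape paths under pruning. For STRIPS, both
the branching factor and finite values of `h⁺` are at most the number of operators. -/

namespace EHCRRW

/-! ### Expectations with respect to probability mass functions -/

/-- The expectation of a nonnegative extended real function. -/
noncomputable def expect {α : Type*} (p : PMF α) (f : α → ℝ≥0∞) : ℝ≥0∞ := ∑' x, p x * f x

section Expect

variable {α β : Type*}

lemma expect_pure (a : α) (f : α → ℝ≥0∞) : expect (PMF.pure a) f = f a := by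
  classical
  unfold expect
  rw [tsum_eq_single a]
  · simp
  · intro b hb
    simp [PMF.pure_apply, hb]

lemma expect_bind (p : PMF α) (g : α → PMF β) (f : β → ℝ≥0∞) :
    expect (p.bind g) f = expect p fun a => expect (g a) f := by
  unfold expect
  simp_rw [PMF.bind_apply, ← ENNReal.tsum_mul_right, ← ENNReal.tsum_mul_left]
  rw [ENNReal.tsum_comm]
  simp_rw [mul_assoc]

lemma expect_map (p : PMF α) (g : α → β) (f : β → ℝ≥0∞) :
    expect (p.map g) f = expect p fun a => f (g a) := by
  rw [← PMF.bind_pure_comp, expect_bind]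
  simp [expect_pure]

lemma expect_add (p : PMF α) (f g : α → ℝ≥0∞) :
    expect p (fun x => f x + g x) = expect p f + expect p g := by
  unfold expect
  simp_rw [mul_add]
  exact ENNReal.tsum_add

lemma expect_const (p : PMF α) (c : ℝ≥0∞) : expect p (fun _ => c) = c := by
  unfold expect
  rw [ENNReal.tsum_mul_right, p.tsum_coe, one_mul]

lemma expect_mul_const (p : PMF α) (f : α → ℝ≥0∞) (c : ℝ≥0∞) :
    expect p (fun x => f x * c) = expect p f * c := by
  unfold expect
  rw [← ENNReal.tsum_mul_right]
  simp_rw [mul_assoc]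

lemma expect_mono (p : PMF α) {f g : α → ℝ≥0∞} (h : ∀ x ∈ p.support, f x ≤ g x) :
    expect p f ≤ expect p g := by
  refine ENNReal.tsum_le_tsum fun x => ?_
  by_cases hx : p x = 0
  · simp [hx]
  · gcongr
    exact h x ((p.mem_support_iff x).2 hx)

end Expect

/-! ### A single random walk -/

section Walk

variable {S : Type u} {succ : S → Finset S} {goal : S → Prop}

lemma goal_and_le_of_mem_support_randomWalk :
    ∀ (d : ℕ) (s : S), ∀ r ∈ (randomWalk succ goal d s).support,
      (∀ t, r.1 = some t → goal t) ∧ r.2 ≤ d := by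
  intro d
  induction d with
  | zero =>
    intro s r hr
    simp only [randomWalk, PMF.support_pure, Set.mem_singleton_iff] at hr
    simp [hr]
  | succ d ih =>
    intro s r hr
    rw [randomWalk] at hr
    split_ifs at hr with hs
    · rw [PMF.mem_support_bind_iff] at hr
      obtain ⟨s', -, hr⟩ := hr
      split_ifs at hr with hg
      · simp only [PMF.support_pure, Set.mem_singleton_iff] at hr
        subst hr
        simp [hg]
      · rw [PMF.mem_support_map_iff] at hr
        obtain ⟨r', hr', rfl⟩ := hr
        obtain ⟨h1, h2⟩ := ih s' r' hr'
        exact ⟨h1, by simpa using h2⟩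
    · simp only [PMF.support_pure, Set.mem_singleton_iff] at hr
      simp [hr]

/-- The indicator of the failure of a random walk. -/
def failed (r : Option S × ℕ) : ℝ≥0∞ :=
  match r.1 with
  | none => 1
  | some _ => 0

/-- The indicator of the success of a random walk. -/
def succeeded (r : Option S × ℕ) : ℝ≥0∞ :=
  match r.1 with
  | none => 0
  | some _ => 1

/-- Each step of the given path is sampled with probability at least `1 / B`; all other walks are
discarded. -/
lemma succeeded_le_expect {T : SearchTask S} {B : ℕ} (hB : ∀ s, (T.succ s).card ≤ B) :
    ∀ (k d : ℕ) (s w : S), T.HasPath (k + 1) s w → goal w → k + 1 ≤ d →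
      ((B : ℝ≥0∞)⁻¹) ^ (k + 1) ≤ expect (randomWalk T.succ goal d s) succeeded := by
  intro k
  induction k with
  | zero =>
    intro d s w hp hg hd
    obtain ⟨d, rfl⟩ : ∃ e, d = e + 1 := ⟨d - 1, by omega⟩
    obtain ⟨v, hv, hvw⟩ := hp
    obtain rfl : v = w := hvw
    have hs : (T.succ s).Nonempty := ⟨v, hv⟩
    rw [randomWalk, dif_pos hs, expect_bind]
    refine le_trans ?_ (ENNReal.le_tsum v)
    rw [PMF.uniformOfFinset_apply_of_mem _ hv]
    beta_reduce
    rw [if_pos hg, expect_pure]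
    simp only [succeeded, zero_add, pow_one, mul_one]
    gcongr
    exact hB s
  | succ k ih =>
    intro d s w hp hg hd
    obtain ⟨d, rfl⟩ : ∃ e, d = e + 1 := ⟨d - 1, by omega⟩
    obtain ⟨v, hv, hvw⟩ := hp
    have hs : (T.succ s).Nonempty := ⟨v, hv⟩
    rw [randomWalk, dif_pos hs, expect_bind]
    refine le_trans ?_ (ENNReal.le_tsum v)
    rw [PMF.uniformOfFinset_apply_of_mem _ hv]
    have hB1 : ((B : ℝ≥0∞)⁻¹) ≤ ((T.succ s).card : ℝ≥0∞)⁻¹ := by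
      gcongr
      exact hB s
    rw [pow_succ' _ (k + 1)]
    refine mul_le_mul' hB1 ?_
    beta_reduce
    split_ifs with hgv
    -- The path may meet an escape state before its end; the walk then succeeds at once.
    · rw [expect_pure]
      refine pow_le_one' (ENNReal.inv_le_one.2 ?_) _
      exact_mod_cast (Finset.card_pos.2 hs).trans_le (hB s)
    · rw [expect_map]
      exact ih d v w hvw hg (by omega)

lemma expect_failed_le {p : PMF (Option S × ℕ)} {a : ℝ≥0∞} (h : a ≤ expect p succeeded) :
    expect p failed ≤ 1 - a := by
  have h1 : expect p failed + expect p succeeded = 1 := by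
    rw [← expect_add, ← expect_const p 1]
    congr 1
    funext r
    rcases r with ⟨_ | _, _⟩ <;> simp [failed, succeeded]
  have h2 : expect p succeeded ≠ ⊤ := ne_top_of_le_ne_top ENNReal.one_ne_top (h1 ▸ le_add_self)
  calc expect p failed = 1 - expect p succeeded := by
        rw [← h1, ENNReal.add_sub_cancel_right h2]
    _ ≤ 1 - a := tsub_le_tsub_left h 1

end Walk

/-! ### The cost of a sequence of walks -/

/-- The expected total cost of the trials from number `i` on, where trial `j` costs `c j` and is
followed by another one with probability `q j`. -/
noncomputable def remaining (c q : ℕ → ℝ≥0∞) (i : ℕ) : ℝ≥0∞ :=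
  ∑' j, c (i + j) * ∏ l ∈ Finset.range j, q (i + l)

lemma remaining_eq (c q : ℕ → ℝ≥0∞) (i : ℕ) :
    remaining c q i = c i + q i * remaining c q (i + 1) := by
  unfold remaining
  rw [tsum_eq_zero_add' ENNReal.summable, ← ENNReal.tsum_mul_left]
  simp only [add_zero, Finset.range_zero, Finset.prod_empty, mul_one]
  congr 1
  refine tsum_congr fun j => ?_
  rw [Finset.prod_range_succ']
  simp only [add_zero, add_assoc, add_comm 1]
  ring

/-! ### A potential function for enforced hill-climbing -/

namespace SearchTask

variable {S : Type u}

/-- The indicator of the runs that have not stopped. -/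
def running : Status S → ℝ≥0∞
  | Status.halted => 0
  | _ => 1

/-- Summing the drift inequality over the steps bounds the expected tests plus the expected number
of steps before stopping. The `running` term is what excludes infinite runs. -/
lemma expectedRuntime_le_of_potential {T : SearchTask S} {h : S → ℕ∞} {depth : ℕ → ℕ}
    (V : Status S → ℝ≥0∞)
    (hV : ∀ σ, running σ + expect (T.step h depth σ) (fun y => (y.2 : ℝ≥0∞) + V y.1) ≤ V σ) :
    T.expectedRuntime h depth ≤ V (Status.call T.init) := by
  rcases eq_or_ne (V (Status.call T.init)) ⊤ with htop | htop
  · simp [htop]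
  have key : ∀ n, (expect (T.run h depth n) fun x => (x.2 : ℝ≥0∞) + V x.1) +
      ∑ j ∈ Finset.range n, (expect (T.run h depth j) fun x => running x.1) ≤
        V (Status.call T.init) := by
    intro n
    induction n with
    | zero => simp [run, expect_pure]
    | succ n ih =>
      refine le_trans ?_ ih
      rw [Finset.sum_range_succ_comm, ← add_assoc]
      gcongr
      rw [run, expect_bind, ← expect_add]
      refine expect_mono _ fun x _ => ?_
      rw [expect_map]
      simp only [Nat.cast_add, add_assoc]
      rw [expect_add, expect_const, add_assoc, add_comm (expect _ _)]
      gcongr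
      exact hV x.1
  have hprob : ∀ n, (T.run h depth n).toOuterMeasure {x | x.1 ≠ Status.halted} =
      expect (T.run h depth n) fun x => running x.1 := by
    intro n
    rw [PMF.toOuterMeasure_apply]
    refine tsum_congr fun x => ?_
    rcases x with ⟨_ | _ | _, k⟩ <;> simp [Set.indicator, running]
  have hinf : ⨅ n, (T.run h depth n).toOuterMeasure {x | x.1 ≠ Status.halted} = 0 := by
    set ε := ⨅ n, (T.run h depth n).toOuterMeasure {x | x.1 ≠ Status.halted} with hε
    by_contra hne
    -- If the run went on forever with probability `ε > 0`, the first `n` steps alone would charge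
    -- `n * ε`, which is unbounded.
    obtain ⟨n, hn⟩ := ENNReal.exists_nat_mul_gt hne htop
    refine absurd hn (not_lt.2 ?_)
    refine le_trans ?_ (le_trans le_add_self (key n))
    calc (n : ℝ≥0∞) * ε = ∑ _j ∈ Finset.range n, ε := by simp
      _ ≤ _ := Finset.sum_le_sum fun j _ => by
        rw [← hprob]
        exact iInf_le _ j
  rw [expectedRuntime, hinf, mul_zero, add_zero]
  refine iSup_le fun n => ?_
  refine le_trans ?_ (le_trans le_self_add (key n))
  exact expect_mono _ fun x _ => le_self_add

open Classical in
/-- Bounds for the expected remaining cost: `R i` is spent in a search before its `i`-th walk, and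
`W` in a whole search. -/
noncomputable def potential (T : SearchTask S) (h : S → ℕ∞) (R : ℕ → ℝ≥0∞) (W : ℝ≥0∞) :
    Status S → ℝ≥0∞
  | Status.halted => 0
  | Status.call s => if T.goal s then 3 else ((h s : ℝ≥0∞) + 1) * W
  | Status.walk s i => if T.goal s ∨ h s = ⊤ then ⊤ else (h s : ℝ≥0∞) * W + R i

lemma potential_next_le {T : SearchTask S} {h : S → ℕ∞} (R : ℕ → ℝ≥0∞) (W : ℝ≥0∞) {s t : S}
    (ht : T.uhrGoal h s t) : potential T h R W (T.next t) ≤ (h s : ℝ≥0∞) * W := by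
  unfold next
  split_ifs with hg
  · simp [potential]
  · have hlt : h t < h s := ht.resolve_left hg
    simp only [potential, if_neg hg]
    gcongr
    have := Order.add_one_le_of_lt hlt
    exact_mod_cast this

/-- Walk `i` is charged `depth i + 2`: its samples, the goal test after a success, and the unit for
`running`. A search gets `W = R 0 + 2`, the 2 being its initial test and the unit of that step. A
goal at the start costs 3: two tests and one unit. -/
lemma expectedRuntime_le_of_failed_le {T : SearchTask S} {h : S → ℕ∞} {depth : ℕ → ℕ}
    (q : ℕ → ℝ≥0∞)
    (hq : ∀ s, ¬ T.goal s → h s ≠ ⊤ → ∀ i,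
      expect (randomWalk T.succ (T.uhrGoal h s) (depth i) s) failed ≤ q i) :
    (T.goal T.init → T.expectedRuntime h depth ≤ 3) ∧
    (¬ T.goal T.init → T.expectedRuntime h depth ≤
      ((h T.init : ℝ≥0∞) + 1) * (remaining (fun i => (depth i : ℝ≥0∞) + 2) q 0 + 2)) := by
  set R := remaining (fun i => (depth i : ℝ≥0∞) + 2) q with hR
  have main : T.expectedRuntime h depth ≤ potential T h R (R 0 + 2) (Status.call T.init) := by
    refine expectedRuntime_le_of_potential _ fun σ => ?_
    cases σ with
    | halted => simp [step, expect_pure, running, potential]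
    | call s =>
      by_cases hg : T.goal s
      · have hu : T.uhrGoal h s s := Or.inl hg
        simp only [step, if_pos hu, expect_pure, running, potential, next, if_pos hg, add_zero]
        norm_num
      · have hu : ¬ T.uhrGoal h s s := by simp [uhrGoal, hg]
        simp only [step, if_neg hu, expect_pure, running, potential, if_neg hg, Nat.cast_one]
        by_cases ht : h s = ⊤
        · simp [ht]
        · simp only [ht, hg, or_self, if_false]
          rw [add_mul, one_mul]
          apply le_of_eq
          ring
    | walk s i =>
      by_cases hbad : T.goal s ∨ h s = ⊤
      · simp [potential, hbad]
      · have hg : ¬ T.goal s := fun h' => hbad (Or.inl h')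
        have ht : h s ≠ ⊤ := fun h' => hbad (Or.inr h')
        simp only [step, running, expect_map]
        set W := R 0 + 2
        calc 1 + expect (randomWalk T.succ (T.uhrGoal h s) (depth i) s) _
            ≤ 1 + expect (randomWalk T.succ (T.uhrGoal h s) (depth i) s)
                (fun r => ((depth i : ℝ≥0∞) + 1 + (h s : ℝ≥0∞) * W) + failed r * R (i + 1)) := by
              gcongr
              refine expect_mono _ fun r hr => ?_
              obtain ⟨h1, h2⟩ := goal_and_le_of_mem_support_randomWalk _ _ r hr
              have h2' : (r.2 : ℝ≥0∞) ≤ depth i := by exact_mod_cast h2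
              rcases r with ⟨_ | t, k⟩
              · simp only [potential, if_neg hbad, failed, one_mul]
                calc (k : ℝ≥0∞) + ((h s : ℝ≥0∞) * W + R (i + 1))
                    ≤ ((depth i : ℝ≥0∞) + 1) + ((h s : ℝ≥0∞) * W + R (i + 1)) := by
                      gcongr
                      exact h2'.trans le_self_add
                  _ = _ := by ring
              · simp only [failed, zero_mul, add_zero]
                push_cast
                gcongr
                exact potential_next_le R W (h1 t rfl)
          _ = (h s : ℝ≥0∞) * W + ((depth i : ℝ≥0∞) + 2 +
                expect (randomWalk T.succ (T.uhrGoal h s) (depth i) s) failed * R (i + 1)) := by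
              rw [expect_add, expect_const, expect_mul_const,
                show (2 : ℝ≥0∞) = 1 + 1 by norm_num]
              ring
          _ ≤ (h s : ℝ≥0∞) * W + ((depth i : ℝ≥0∞) + 2 + q i * R (i + 1)) := by
              gcongr
              exact hq s hg ht i
          _ = potential T h R W (Status.walk s i) := by
              simp only [potential, if_neg hbad]
              rw [hR, remaining_eq _ _ i]
  constructor
  · intro hg
    simpa [potential, hg] using main
  · intro hg
    simpa [potential, hg] using main

end SearchTask

end EHCRRW

namespace EHCRRW

/-! ### The Luby sequence -/

lemma lubyDepth_last (m : ℕ) : lubyDepth (2 ^ m - 1 + (2 ^ m - 1)) = 2 ^ m := by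
  have hm : 1 ≤ 2 ^ m := Nat.one_le_two_pow
  have hlog : Nat.log 2 (2 ^ m - 1 + (2 ^ m - 1) + 1) = m := by
    rw [Nat.log_eq_iff (Or.inr ⟨by norm_num, by omega⟩), pow_succ]
    omega
  rw [lubyDepth, luby, if_neg (by omega), hlog, if_pos (by rw [pow_succ]; omega)]

lemma lubyDepth_add {m i : ℕ} (hi : i < 2 ^ m - 1) :
    lubyDepth (2 ^ m - 1 + i) = lubyDepth i := by
  have hlog : Nat.log 2 (2 ^ m - 1 + i + 1) = m := by
    rw [Nat.log_eq_iff (Or.inr ⟨by norm_num, by omega⟩), pow_succ]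
    omega
  rw [lubyDepth, luby, if_neg (by omega), hlog, if_neg (by rw [pow_succ]; omega), lubyDepth]
  congr 1
  omega

lemma one_le_luby (i : ℕ) (hi : i ≠ 0) : 1 ≤ luby i := by
  induction i using Nat.strong_induction_on with
  | _ i ih =>
    rw [luby, if_neg hi]
    split_ifs with h1
    · exact Nat.one_le_two_pow
    · have h2 : 2 ^ Nat.log 2 i ≤ i := Nat.pow_log_le_self 2 hi
      have h3 : i < 2 ^ (Nat.log 2 i + 1) := Nat.lt_pow_succ_log_self (by norm_num) i
      have h4 : 2 ≤ 2 ^ Nat.log 2 i := by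
        rcases Nat.eq_zero_or_pos (Nat.log 2 i) with hk | hk
        · rw [hk] at h1 h3
          omega
        · exact Nat.pow_le_pow_right (n := 2) (by norm_num) hk
      exact ih _ (by omega) (by omega)

lemma one_le_lubyDepth (i : ℕ) : 1 ≤ lubyDepth i := one_le_luby _ (by omega)

lemma two_pow_succ_sub_one (m : ℕ) : 2 ^ (m + 1) - 1 = 2 ^ m - 1 + (2 ^ m - 1) + 1 := by
  have hm : 1 ≤ 2 ^ m := Nat.one_le_two_pow
  rw [pow_succ]
  omega

/-- The left side is the total limit of the second copy of a block together with the long walk that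
closes the doubled block. -/
lemma sum_lubyDepth_add_le (m : ℕ) :
    (∑ i ∈ Finset.range (2 ^ m - 1), (lubyDepth i : ℝ)) + 2 ^ m ≤ (m + 1) * 2 ^ m := by
  induction m with
  | zero => simp
  | succ m ih =>
    rw [two_pow_succ_sub_one, Finset.sum_range_succ, Finset.sum_range_add, lubyDepth_last]
    have h : ∑ x ∈ Finset.range (2 ^ m - 1), (lubyDepth (2 ^ m - 1 + x) : ℝ) =
        ∑ x ∈ Finset.range (2 ^ m - 1), (lubyDepth x : ℝ) :=
      Finset.sum_congr rfl fun x hx => by rw [lubyDepth_add (Finset.mem_range.1 hx)]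
    rw [h, pow_succ]
    push_cast
    nlinarith [pow_pos (two_pos : (0 : ℝ) < 2) m]

/-! ### Survival and cost along the dyadic blocks of the Luby sequence -/

section Blocks

variable (g : ℕ → ℝ)

/-- The probability that the first `i` walks fail. -/
noncomputable def survival (i : ℕ) : ℝ := ∏ l ∈ Finset.range i, g (lubyDepth l)

/-- The expected cost of the first `n` walks. -/
noncomputable def lubyCost (n : ℕ) : ℝ :=
  ∑ i ∈ Finset.range n, (lubyDepth i : ℝ) * survival g i

variable {g}

lemma survival_nonneg (h0 : ∀ d, 0 ≤ g d) (i : ℕ) : 0 ≤ survival g i :=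
  Finset.prod_nonneg fun _ _ => h0 _

lemma survival_le_one (h0 : ∀ d, 0 ≤ g d) (h1 : ∀ d, g d ≤ 1) (i : ℕ) : survival g i ≤ 1 :=
  Finset.prod_le_one (fun _ _ => h0 _) fun _ _ => h1 _

lemma survival_add {m i : ℕ} (hi : i ≤ 2 ^ m - 1) :
    survival g (2 ^ m - 1 + i) = survival g (2 ^ m - 1) * survival g i := by
  unfold survival
  rw [Finset.prod_range_add]
  congr 1
  refine Finset.prod_congr rfl fun x hx => ?_
  rw [lubyDepth_add ((Finset.mem_range.1 hx).trans_le hi)]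

lemma survival_two_pow_succ (m : ℕ) :
    survival g (2 ^ (m + 1) - 1) = survival g (2 ^ m - 1) ^ 2 * g (2 ^ m) := by
  rw [two_pow_succ_sub_one, survival, Finset.prod_range_succ, lubyDepth_last, ← survival,
    survival_add le_rfl, sq]

/-- Everything after the first copy of the block is paid only if that copy failed, which gives the
factor `survival`. -/
lemma lubyCost_two_pow_succ_le (h0 : ∀ d, 0 ≤ g d) (h1 : ∀ d, g d ≤ 1) (m : ℕ) :
    lubyCost g (2 ^ (m + 1) - 1) ≤
      lubyCost g (2 ^ m - 1) + survival g (2 ^ m - 1) * ((m + 1) * 2 ^ m) := by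
  have hs0 := survival_nonneg h0
  have hs1 := survival_le_one h0 h1
  rw [two_pow_succ_sub_one, lubyCost, Finset.sum_range_succ, Finset.sum_range_add, lubyDepth_last,
    survival_add le_rfl, ← lubyCost, add_assoc]
  refine add_le_add_right ?_ _
  refine le_trans ?_ (mul_le_mul_of_nonneg_left (sum_lubyDepth_add_le m) (hs0 _))
  rw [mul_add, Finset.mul_sum]
  refine add_le_add (Finset.sum_le_sum fun i hi => ?_) ?_
  · rw [lubyDepth_add (Finset.mem_range.1 hi), survival_add (Finset.mem_range.1 hi).le]
    have : survival g (2 ^ m - 1) * survival g i ≤ survival g (2 ^ m - 1) :=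
      mul_le_of_le_one_right (hs0 _) (hs1 _)
    rw [mul_comm]
    gcongr
  · have : survival g (2 ^ m - 1) * survival g (2 ^ m - 1) ≤ survival g (2 ^ m - 1) :=
      mul_le_of_le_one_right (hs0 _) (hs1 _)
    push_cast
    rw [mul_comm]
    gcongr

lemma lubyCost_two_pow_le (h0 : ∀ d, 0 ≤ g d) (h1 : ∀ d, g d ≤ 1) (m : ℕ) :
    lubyCost g (2 ^ m - 1) ≤ (m + 1) * 2 ^ m := by
  refine le_trans ?_ (sum_lubyDepth_add_le m)
  refine le_add_of_le_of_nonneg (Finset.sum_le_sum fun i _ => ?_) (by positivity)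
  exact mul_le_of_le_one_right (by positivity) (survival_le_one h0 h1 i)

lemma three_mul_le_two_pow_add (t : ℕ) : 3 * t ≤ 2 ^ t + 2 := by
  induction t with
  | zero => simp
  | succ t ih =>
    rcases Nat.lt_or_ge t 2 with ht | ht
    · interval_cases t <;> norm_num
    · have : 2 ^ 2 ≤ 2 ^ t := Nat.pow_le_pow_right (by norm_num) ht
      rw [pow_succ]
      omega

/-- One factor `2 ^ t` will account for the longer walks and the other for the linear factor in the
block cost. -/
lemma half_pow_two_pow_mul_le (t : ℕ) : (1 / 2 : ℝ) ^ (2 ^ t) * (2 ^ t * 2 ^ t) ≤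
    4 * (1 / 2) ^ t := by
  have h : (2 : ℝ) ^ (3 * t) ≤ 2 ^ (2 ^ t + 2) :=
    pow_le_pow_right₀ (by norm_num) (three_mul_le_two_pow_add t)
  rw [one_div, inv_pow, inv_pow, inv_mul_eq_div, ← div_eq_mul_inv, div_le_div_iff₀ (by positivity)
    (by positivity)]
  calc (2 : ℝ) ^ t * 2 ^ t * 2 ^ t = 2 ^ (3 * t) := by
        rw [mul_comm 3, pow_mul]
        ring
    _ ≤ 2 ^ (2 ^ t + 2) := h
    _ = 4 * 2 ^ 2 ^ t := by rw [pow_add]; ring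

lemma lubyCost_add_le (h0 : ∀ d, 0 ≤ g d) (h1 : ∀ d, g d ≤ 1) {M : ℕ}
    (hM : survival g (2 ^ M - 1) ≤ 1 / 2) (r : ℕ) :
    lubyCost g (2 ^ (M + r) - 1) ≤ 9 * ((M + 1) * 2 ^ M) := by
  have hs : ∀ t, survival g (2 ^ (M + t) - 1) ≤ (1 / 2) ^ (2 ^ t) := by
    intro t
    induction t with
    | zero => simpa using hM
    | succ t ih =>
      rw [← add_assoc, survival_two_pow_succ, pow_succ 2 t, pow_mul]
      refine (mul_le_of_le_one_right (sq_nonneg _) (h1 _)).trans ?_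
      exact pow_le_pow_left₀ (survival_nonneg h0 _) ih 2
  -- The correction `8 * (1 / 2) ^ r` makes the induction telescope: its drop from `r` to `r + 1` is
  -- exactly the increment `4 * (1 / 2) ^ r`.
  have key : lubyCost g (2 ^ (M + r) - 1) ≤ (9 - 8 * (1 / 2) ^ r) * ((M + 1) * 2 ^ M) := by
    induction r with
    | zero =>
      refine (lubyCost_two_pow_le h0 h1 M).trans (le_of_eq ?_)
      norm_num
    | succ r ih =>
      refine (lubyCost_two_pow_succ_le h0 h1 (M + r)).trans ?_
      have hterm : survival g (2 ^ (M + r) - 1) * (((M + r : ℕ) + 1) * 2 ^ (M + r)) ≤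
          4 * (1 / 2) ^ r * ((M + 1) * 2 ^ M) := by
        have hr : (r : ℝ) + 1 ≤ 2 ^ r := by
          exact_mod_cast Nat.lt_two_pow_self (n := r)
        have h2 : ((M + r : ℕ) : ℝ) + 1 ≤ (M + 1) * 2 ^ r := by
          push_cast
          have hM0 : (0 : ℝ) ≤ M := Nat.cast_nonneg M
          have hr0 : (0 : ℝ) ≤ r := Nat.cast_nonneg r
          nlinarith
        calc survival g (2 ^ (M + r) - 1) * (((M + r : ℕ) + 1) * 2 ^ (M + r))
            ≤ (1 / 2) ^ (2 ^ r) * (((M + 1) * 2 ^ r) * 2 ^ (M + r)) := by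
              gcongr
              exact hs r
          _ = ((1 / 2) ^ (2 ^ r) * (2 ^ r * 2 ^ r)) * ((M + 1) * 2 ^ M) := by
              rw [pow_add]
              ring
          _ ≤ _ := mul_le_mul_of_nonneg_right (half_pow_two_pow_mul_le r) (by positivity)
      calc _ ≤ (9 - 8 * (1 / 2) ^ r) * ((M + 1) * 2 ^ M) +
            4 * (1 / 2) ^ r * (((M : ℝ) + 1) * 2 ^ M) := add_le_add ih hterm
        _ = _ := by
            rw [pow_succ]
            ring
  refine key.trans ?_
  gcongr
  have : (0 : ℝ) ≤ 8 * (1 / 2) ^ r := by positivity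
  linarith

lemma lubyCost_mono (h0 : ∀ d, 0 ≤ g d) : Monotone (lubyCost g) := fun _ _ hab =>
  Finset.sum_le_sum_of_subset_of_nonneg (Finset.range_mono hab) fun i _ _ =>
    mul_nonneg (Nat.cast_nonneg _) (survival_nonneg h0 i)

lemma lubyCost_le (h0 : ∀ d, 0 ≤ g d) (h1 : ∀ d, g d ≤ 1) {M : ℕ}
    (hM : survival g (2 ^ M - 1) ≤ 1 / 2) (n : ℕ) :
    lubyCost g n ≤ 9 * ((M + 1) * 2 ^ M) := by
  refine (lubyCost_mono h0 ?_).trans (lubyCost_add_le h0 h1 hM n)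
  have h2 : n < 2 ^ n := Nat.lt_two_pow_self
  have h3 : 2 ^ n ≤ 2 ^ (M + n) := Nat.pow_le_pow_right (by norm_num) (by omega)
  omega

end Blocks

/-- The probability of the failure of a walk with depth limit `d`, if the walks with limit at least
`D + 1` succeed with probability `1 / N`, and the others always fail. -/
noncomputable def failBound (D N d : ℕ) : ℝ := if D + 1 ≤ d then 1 - 1 / (N : ℝ) else 1

lemma one_div_nat_le_one {N : ℕ} (hN : 1 ≤ N) : 1 / (N : ℝ) ≤ 1 :=
  (div_le_one (by exact_mod_cast hN)).2 (by exact_mod_cast hN)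

lemma failBound_nonneg {N : ℕ} (hN : 1 ≤ N) (D d : ℕ) : 0 ≤ failBound D N d := by
  have := one_div_nat_le_one hN
  unfold failBound
  split_ifs <;> linarith

lemma failBound_le_one (D N d : ℕ) : failBound D N d ≤ 1 := by
  have : 0 ≤ 1 / (N : ℝ) := by positivity
  unfold failBound
  split_ifs <;> linarith

/-- The block of level `k + 1` ends with a walk of limit `2 ^ k ≥ D + 1`, so survival there is at
most `1 - 1 / N`. Squaring it `n` times gives the exponent `2 ^ n ≥ N`, hence at most `exp (-1)`. -/
lemma survival_failBound_le {D N k n : ℕ} (hN : 1 ≤ N) (hk : D + 1 ≤ 2 ^ k) (hn : N ≤ 2 ^ n) :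
    survival (failBound D N) (2 ^ (k + 1 + n) - 1) ≤ 1 / 2 := by
  have hq0 : 0 ≤ 1 - 1 / (N : ℝ) := sub_nonneg.2 (one_div_nat_le_one hN)
  have hq1 : 1 - 1 / (N : ℝ) ≤ 1 := sub_le_self _ (by positivity)
  have h0 := failBound_nonneg hN D
  have h1 := failBound_le_one D N
  have hs : ∀ t, survival (failBound D N) (2 ^ (k + 1 + t) - 1) ≤ (1 - 1 / (N : ℝ)) ^ 2 ^ t := by
    intro t
    induction t with
    | zero =>
      rw [add_zero, survival_two_pow_succ]
      refine (mul_le_of_le_one_left (h0 _) ?_).trans ?_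
      · exact pow_le_one₀ (survival_nonneg h0 _) (survival_le_one h0 h1 _)
      · simp [failBound, hk]
    | succ t ih =>
      rw [← add_assoc, survival_two_pow_succ, pow_succ 2 t, pow_mul]
      refine (mul_le_of_le_one_right (sq_nonneg _) (h1 _)).trans ?_
      exact pow_le_pow_left₀ (survival_nonneg h0 _) ih 2
  calc _ ≤ (1 - 1 / (N : ℝ)) ^ 2 ^ n := hs n
    _ ≤ (1 - 1 / (N : ℝ)) ^ N := pow_le_pow_of_le_one hq0 hq1 hn
    _ ≤ Real.exp (-1) := Real.one_sub_div_pow_le_exp_neg (by exact_mod_cast hN)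
    _ ≤ 1 / 2 := by
        rw [Real.exp_neg, one_div]
        have := Real.add_one_le_exp (1 : ℝ)
        gcongr
        linarith

lemma exists_two_pow {n : ℕ} (hn : 1 ≤ n) : ∃ k, n ≤ 2 ^ k ∧ 2 ^ k ≤ 2 * n := by
  refine ⟨Nat.log 2 n + 1, (Nat.lt_pow_succ_log_self (by norm_num) n).le, ?_⟩
  rw [pow_succ, mul_comm]
  exact Nat.mul_le_mul_left 2 (Nat.pow_log_le_self 2 (by omega))

lemma lubyCost_failBound_le {D N : ℕ} (hN : 1 ≤ N) (n : ℕ) :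
    lubyCost (failBound D N) n ≤
      300 * ((((D + 1) * N : ℕ) : ℝ) * (1 + Real.log (((D + 1) * N : ℕ) : ℝ))) := by
  obtain ⟨k, hk1, hk2⟩ := exists_two_pow (n := D + 1) (by omega)
  obtain ⟨m, hm1, hm2⟩ := exists_two_pow hN
  refine (lubyCost_le (failBound_nonneg hN D) (failBound_le_one D N)
    (survival_failBound_le hN hk1 hm1) n).trans ?_
  set X : ℝ := (((D + 1) * N : ℕ) : ℝ) with hX
  have hX1 : 1 ≤ X := by
    have : 1 ≤ (D + 1) * N := Nat.mul_pos (by omega) hN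
    rw [hX]
    exact_mod_cast this
  have hpow : (2 : ℝ) ^ (k + 1 + m) ≤ 8 * X := by
    have : 2 ^ (k + 1 + m) ≤ 8 * ((D + 1) * N) := by
      calc 2 ^ (k + 1 + m) = 2 * (2 ^ k * 2 ^ m) := by ring
        _ ≤ 2 * ((2 * (D + 1)) * (2 * N)) := by gcongr
        _ = _ := by ring
    rw [hX]
    exact_mod_cast this
  have hlog2 := Real.log_two_gt_d9
  have hlog0 : 0 ≤ Real.log X := Real.log_nonneg hX1
  have hexp : ((k + 1 + m : ℕ) : ℝ) * Real.log 2 ≤ 3 * Real.log 2 + Real.log X := by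
    rw [← Real.log_pow]
    refine (Real.log_le_log (by positivity) hpow).trans (le_of_eq ?_)
    rw [Real.log_mul (by norm_num) (by positivity), show (8 : ℝ) = 2 ^ 3 by norm_num, Real.log_pow]
    norm_num
  -- Dividing `hexp` by `log 2 > 1 / 4` suffices.
  have hM : ((k + 1 + m : ℕ) : ℝ) + 1 ≤ 4 * (1 + Real.log X) := by
    by_contra hcon
    push Not at hcon
    nlinarith
  calc 9 * ((((k + 1 + m : ℕ) : ℝ) + 1) * 2 ^ (k + 1 + m))
      ≤ 9 * ((4 * (1 + Real.log X)) * (8 * X)) := by gcongr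
    _ ≤ _ := by nlinarith [mul_nonneg (zero_le_one.trans hX1) (add_nonneg zero_le_one hlog0)]

lemma remaining_lubyDepth_le {D N : ℕ} (hN : 1 ≤ N) :
    remaining (fun i => (lubyDepth i : ℝ≥0∞) + 2)
        (fun i => ENNReal.ofReal (failBound D N (lubyDepth i))) 0 ≤
      ENNReal.ofReal (900 * ((((D + 1) * N : ℕ) : ℝ) *
        (1 + Real.log (((D + 1) * N : ℕ) : ℝ)))) := by
  have h0 := failBound_nonneg hN D
  unfold remaining
  simp only [zero_add]
  rw [ENNReal.tsum_eq_iSup_nat]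
  refine iSup_le fun n => ?_
  have hle : ∑ i ∈ Finset.range n, ((lubyDepth i : ℝ≥0∞) + 2) *
      ∏ l ∈ Finset.range i, ENNReal.ofReal (failBound D N (lubyDepth l)) ≤
      ENNReal.ofReal (3 * lubyCost (failBound D N) n) := by
    rw [lubyCost, Finset.mul_sum, ENNReal.ofReal_sum_of_nonneg fun i _ => mul_nonneg (by norm_num)
      (mul_nonneg (Nat.cast_nonneg _) (survival_nonneg h0 i))]
    refine Finset.sum_le_sum fun i _ => ?_
    rw [← mul_assoc, ENNReal.ofReal_mul (by positivity), survival,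
      ENNReal.ofReal_prod_of_nonneg fun l _ => h0 _]
    gcongr
    -- The overhead 2 per walk is absorbed because every Luby limit is at least 1.
    have h1 := one_le_lubyDepth i
    have : ENNReal.ofReal (3 * (lubyDepth i : ℝ)) = ((3 * lubyDepth i : ℕ) : ℝ≥0∞) := by
      rw [← ENNReal.ofReal_natCast]
      push_cast
      rfl
    rw [this]
    have h2 : lubyDepth i + 2 ≤ 3 * lubyDepth i := by omega
    exact_mod_cast h2
  refine hle.trans (ENNReal.ofReal_le_ofReal ?_)
  have := lubyCost_failBound_le (D := D) hN n
  linarith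

lemma remaining_constDepth {ℓ N : ℕ} (hN : 1 ≤ N) :
    remaining (fun _ => (ℓ : ℝ≥0∞) + 2) (fun _ => 1 - (N : ℝ≥0∞)⁻¹) 0 =
      (ℓ + 2) * N := by
  unfold remaining
  simp only [Finset.prod_const, Finset.card_range]
  rw [ENNReal.tsum_mul_left, ENNReal.tsum_geometric, ENNReal.sub_sub_cancel ENNReal.one_ne_top,
    inv_inv]
  exact ENNReal.inv_le_one.2 (by exact_mod_cast hN)

end EHCRRW

namespace EHCRRW

namespace SearchTask

variable {S : Type u}

/-! ### Paths and exits -/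

lemma HasPath.snoc {T : SearchTask S} : ∀ {k : ℕ} {s v w : S},
    T.HasPath k s v → w ∈ T.succ v → T.HasPath (k + 1) s w
  | 0, s, v, w, h, hw => by
    obtain rfl : s = v := h
    exact ⟨w, hw, rfl⟩
  | _ + 1, _, _, _, ⟨u, hu, h⟩, hw => ⟨u, hu, h.snoc hw⟩

lemma HasPath.trans {T : SearchTask S} : ∀ {k l : ℕ} {s v w : S},
    T.HasPath k s v → T.HasPath l v w → ∃ m, T.HasPath m s w
  | 0, l, s, v, w, h, h' => by
    obtain rfl : s = v := h
    exact ⟨l, h'⟩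
  | _ + 1, _, _, _, _, ⟨u, hu, h⟩, h' => by
    obtain ⟨m, hm⟩ := h.trans h'
    exact ⟨m + 1, u, hu, hm⟩

lemma not_isDeadEnd_of_hasPath {T : SearchTask S} {k : ℕ} {s w : S} (hp : T.HasPath k s w)
    (hw : ¬ T.IsDeadEnd w) : ¬ T.IsDeadEnd s := by
  unfold IsDeadEnd at hw ⊢
  push Not at hw ⊢
  obtain ⟨l, t, hl, ht⟩ := hw
  obtain ⟨m, hm⟩ := hp.trans hl
  exact ⟨m, t, hm, ht⟩

/-- Every state on a path to a state that is not a dead end is itself not a dead end, so by safety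
none of its transitions is pruned. -/
lemma HasPath.prune {T : SearchTask S} {h : S → ℕ∞} (hsafe : T.SafeHeuristic h) :
    ∀ {k : ℕ} {s w : S}, T.HasPath k s w → ¬ T.IsDeadEnd w → (T.prune h).HasPath k s w
  | 0, _, _, hp, _ => hp
  | k + 1, s, w, hp, hw => by
    have hs : h s ≠ ⊤ := fun h' => not_isDeadEnd_of_hasPath hp hw (hsafe s h')
    obtain ⟨v, hv, hvw⟩ := hp
    refine ⟨v, ?_, hvw.prune hsafe hw⟩
    simpa [SearchTask.prune, hs] using hv

lemma EHCComplete.isDeadEnd_iff {T : SearchTask S} {h : S → ℕ∞} (hc : T.EHCComplete h)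
    (hsafe : T.SafeHeuristic h) (s : S) : T.IsDeadEnd s ↔ h s = ⊤ := by
  rcases hc with hc | hc
  · exact ⟨fun h' => (hc s h').elim, hsafe s⟩
  · exact hc s

/-- Follow the path until its next state first passes the escape test. Before that all values are at
least `h s`, so the path has stayed inside the region. -/
lemma exists_isExit {T : SearchTask S} {h : S → ℕ∞} {s t : S} (ht : T.uhrGoal h s t) :
    ∀ (k j : ℕ) (v : S), v ∈ T.uhr h s → T.HasPath j s v → T.HasPath (k + 1) v t →
      ∃ m w, T.IsExit h s w ∧ T.HasPath m s w := by
  intro k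
  induction k with
  | zero =>
    rintro j v hv hj ⟨w, hw, hwt⟩
    obtain rfl : w = t := hwt
    exact ⟨j, v, ⟨hv, w, hw, ht⟩, hj⟩
  | succ k ih =>
    rintro j v hv hj ⟨w, hw, hwt⟩
    by_cases hg : T.uhrGoal h s w
    · exact ⟨j, v, ⟨hv, w, hw, hg⟩, hj⟩
    · have hle : h s ≤ h w := not_lt.1 fun h' => hg (Or.inr h')
      exact ih (j + 1) w (Relation.ReflTransGen.tail hv ⟨hw, hle⟩) (hj.snoc hw) hwt

lemma exitDist_ne_top {T : SearchTask S} {h : S → ℕ∞} (hc : T.EHCComplete h)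
    (hsafe : T.SafeHeuristic h) {s : S} (hg : ¬ T.goal s) (hs : h s ≠ ⊤) :
    T.exitDist h s ≠ ⊤ := by
  have hd : ¬ T.IsDeadEnd s := fun h' => hs ((hc.isDeadEnd_iff hsafe s).1 h')
  unfold IsDeadEnd at hd
  push Not at hd
  obtain ⟨k, t, hk, ht⟩ := hd
  cases k with
  | zero =>
    obtain rfl : s = t := hk
    exact absurd ht hg
  | succ k =>
    obtain ⟨m, w, hw, hm⟩ :=
      exists_isExit (h := h) (s := s) (Or.inl ht) k 0 s Relation.ReflTransGen.refl rfl hk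
    exact ne_top_of_le_ne_top (ENat.natCast_ne_top m) (iInf₂_le m ⟨w, hw, hm⟩)

lemma maxExitDist_ne_top [Finite S] {T : SearchTask S} {h : S → ℕ∞} (hc : T.EHCComplete h)
    (hsafe : T.SafeHeuristic h) : T.maxExitDist h ≠ ⊤ := by
  cases nonempty_fintype S
  unfold maxExitDist
  rw [← Finset.sup_univ_eq_iSup, ← lt_top_iff_ne_top, Finset.sup_lt_iff ENat.top_pos]
  intro s _
  by_cases h' : ¬ T.goal s ∧ h s ≠ ⊤
  · rw [iSup_pos h']
    exact lt_top_iff_ne_top.2 (exitDist_ne_top hc hsafe h'.1 h'.2)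
  · rw [iSup_neg h']
    exact ENat.top_pos

/-- From every state that is neither a goal nor a recognized dead end, an escape state is at the
end of a path with at most `D + 1` transitions. -/
def EscapesWithin (T : SearchTask S) (h : S → ℕ∞) (D : ℕ) : Prop :=
  ∀ s, ¬ T.goal s → h s ≠ ⊤ → ∃ k ≤ D, ∃ w, T.HasPath (k + 1) s w ∧ T.uhrGoal h s w

lemma escapesWithin_of_maxExitDist_le {T : SearchTask S} {h : S → ℕ∞} {D : ℕ}
    (hD : T.maxExitDist h ≤ D) : T.EscapesWithin h D := by
  intro s hg hs
  have h1 : T.exitDist h s < (D : ℕ∞) + 1 := by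
    refine lt_of_le_of_lt (le_trans ?_ hD) ?_
    · exact le_iSup₂ (f := fun s (_ : ¬ T.goal s ∧ h s ≠ ⊤) => T.exitDist h s) s ⟨hg, hs⟩
    · exact_mod_cast Nat.lt_succ_self D
  unfold exitDist at h1
  simp only [iInf_lt_iff] at h1
  obtain ⟨k, ⟨v, ⟨-, w, hw, hgw⟩, hk⟩, hkD⟩ := h1
  have hkD' : k < D + 1 := by exact_mod_cast hkD
  exact ⟨k, by omega, w, hk.snoc hw, hgw⟩

lemma EscapesWithin.prune {T : SearchTask S} {h : S → ℕ∞} {D : ℕ} (hc : T.EHCComplete h)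
    (hsafe : T.SafeHeuristic h) (hD : T.EscapesWithin h D) : (T.prune h).EscapesWithin h D := by
  intro s hg hs
  obtain ⟨k, hk, w, hw, hgw⟩ := hD s hg hs
  refine ⟨k, hk, w, hw.prune hsafe ?_, hgw⟩
  -- An escape state is not a dead end: it is a goal, or its value lies below `h s` and is thus
  -- finite.
  rcases hgw with hgw | hgw
  · exact fun h' => h' 0 w rfl hgw
  · exact fun h' => hgw.ne_top ((hc.isDeadEnd_iff hsafe w).1 h')

lemma card_succ_prune_le (T : SearchTask S) (h : S → ℕ∞) (s : S) :
    ((T.prune h).succ s).card ≤ (T.succ s).card := by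
  simp only [SearchTask.prune]
  split_ifs <;> simp

/-! ### Runtime bounds -/

lemma expect_failed_randomWalk_le {T : SearchTask S} {h : S → ℕ∞} {B D d : ℕ}
    (hB : ∀ s, (T.succ s).card ≤ B) (hB1 : 1 ≤ B) (hD : T.EscapesWithin h D) (hd : D + 1 ≤ d)
    {s : S} (hg : ¬ T.goal s) (hs : h s ≠ ⊤) :
    expect (randomWalk T.succ (T.uhrGoal h s) d s) failed ≤
      1 - ((B ^ (D + 1) : ℕ) : ℝ≥0∞)⁻¹ := by
  obtain ⟨k, hk, w, hw, hgw⟩ := hD s hg hs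
  refine expect_failed_le (le_trans ?_ (succeeded_le_expect hB k d s w hw hgw (by omega)))
  rw [Nat.cast_pow, ENNReal.inv_pow]
  have hB2 : (B : ℝ≥0∞)⁻¹ ≤ 1 := ENNReal.inv_le_one.2 (by exact_mod_cast hB1)
  exact pow_le_pow_right_of_le_one' hB2 (Nat.succ_le_succ hk)

lemma expect_failed_le_one (p : PMF (Option S × ℕ)) : expect p failed ≤ 1 := by
  simpa using expect_failed_le (p := p) zero_le

lemma EscapesWithin.one_le {T : SearchTask S} {h : S → ℕ∞} {B D : ℕ} (hD : T.EscapesWithin h D)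
    (hB : ∀ s, (T.succ s).card ≤ B) {s : S} (hg : ¬ T.goal s) (hs : h s ≠ ⊤) : 1 ≤ B := by
  obtain ⟨k, -, w, ⟨v, hv, -⟩, -⟩ := hD s hg hs
  exact (Finset.card_pos.2 ⟨v, hv⟩).trans_le (hB s)

lemma expectedRuntime_le_three {T : SearchTask S} (h : S → ℕ∞) (depth : ℕ → ℕ)
    (hg : T.goal T.init) : T.expectedRuntime h depth ≤ 3 :=
  (expectedRuntime_le_of_failed_le (fun _ => 1) fun _ _ _ _ => expect_failed_le_one _).1 hg

lemma heuristic_add_one_le {n : ℕ∞} {K : ℕ} (hn : n ≤ K) (hK : 1 ≤ K) :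
    (n : ℝ≥0∞) + 1 ≤ ((2 * K : ℕ) : ℝ≥0∞) := by
  have h1 : (n : ℝ≥0∞) ≤ (K : ℝ≥0∞) := by exact_mod_cast ENat.toENNReal_le.2 hn
  have h2 : (1 : ℝ≥0∞) ≤ (K : ℝ≥0∞) := by exact_mod_cast hK
  calc (n : ℝ≥0∞) + 1 ≤ K + K := add_le_add h1 h2
    _ = _ := by push_cast; ring

theorem expectedRuntime_constDepth_le {T : SearchTask S} {h : S → ℕ∞} {B D K ℓ : ℕ}
    (hB : ∀ s, (T.succ s).card ≤ B) (hD : T.EscapesWithin h D) (hg : ¬ T.goal T.init)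
    (hi : h T.init ≤ K) (hK : 1 ≤ K) (hℓ : D + 1 ≤ ℓ) :
    T.expectedRuntime h (constDepth ℓ) ≤ ((2000 * K * ℓ * B ^ (D + 1) : ℕ) : ℝ≥0∞) := by
  have hB1 : 1 ≤ B := hD.one_le hB hg (ne_top_of_le_ne_top (ENat.natCast_ne_top K) hi)
  have hN : 1 ≤ B ^ (D + 1) := Nat.one_le_pow _ _ hB1
  refine ((expectedRuntime_le_of_failed_le (fun _ => 1 - ((B ^ (D + 1) : ℕ) : ℝ≥0∞)⁻¹)
    fun s hgs hs i => expect_failed_randomWalk_le hB hB1 hD hℓ hgs hs).2 hg).trans ?_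
  rw [remaining_constDepth hN]
  refine (mul_le_mul' (heuristic_add_one_le hi hK) le_rfl).trans ?_
  have hnat : 2 * K * ((ℓ + 2) * B ^ (D + 1) + 2) ≤ 2000 * K * ℓ * B ^ (D + 1) := by
    have h1 : 1 ≤ ℓ := by omega
    have h2 : (ℓ + 2) * B ^ (D + 1) ≤ (ℓ + 2 * ℓ) * B ^ (D + 1) := by gcongr; omega
    have h3 : 1 * 1 ≤ ℓ * B ^ (D + 1) := Nat.mul_le_mul h1 hN
    calc 2 * K * ((ℓ + 2) * B ^ (D + 1) + 2) ≤ 2 * K * (1000 * (ℓ * B ^ (D + 1))) := by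
          gcongr
          nlinarith
      _ = _ := by ring
  exact_mod_cast hnat

theorem expectedRuntime_lubyDepth_le {T : SearchTask S} {h : S → ℕ∞} {B D K : ℕ}
    (hB : ∀ s, (T.succ s).card ≤ B) (hD : T.EscapesWithin h D) (hg : ¬ T.goal T.init)
    (hi : h T.init ≤ K) (hK : 1 ≤ K) :
    T.expectedRuntime h lubyDepth ≤
      ENNReal.ofReal (((2000 * K * (D + 1) * B ^ (D + 1) : ℕ) : ℝ) *
        (1 + Real.log (((D + 1) * B ^ (D + 1) : ℕ) : ℝ))) := by
  have hB1 : 1 ≤ B := hD.one_le hB hg (ne_top_of_le_ne_top (ENat.natCast_ne_top K) hi)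
  have hN : 1 ≤ B ^ (D + 1) := Nat.one_le_pow _ _ hB1
  refine ((expectedRuntime_le_of_failed_le
    (fun i => ENNReal.ofReal (failBound D (B ^ (D + 1)) (lubyDepth i)))
    fun s hgs hs i => ?_).2 hg).trans ?_
  · unfold failBound
    split_ifs with hd
    · refine (expect_failed_randomWalk_le hB hB1 hD hd hgs hs).trans (le_of_eq ?_)
      rw [ENNReal.ofReal_sub _ (by positivity), one_div, ENNReal.ofReal_inv_of_pos
        (by exact_mod_cast hN), ENNReal.ofReal_natCast, ENNReal.ofReal_one]
    · simpa using expect_failed_le_one _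
  · set X : ℝ := (((D + 1) * B ^ (D + 1) : ℕ) : ℝ) with hX
    have hX1 : 1 ≤ X := by
      have : 1 ≤ (D + 1) * B ^ (D + 1) := Nat.mul_pos (by omega) hN
      rw [hX]
      exact_mod_cast this
    have hY : 1 ≤ X * (1 + Real.log X) := by
      nlinarith [Real.log_nonneg hX1]
    -- With `Y = X * (1 + log X) ≥ 1`, the total is at most `2 * K * (900 * Y + 2) ≤ 2000 * K * Y`.
    refine (mul_le_mul' (heuristic_add_one_le hi hK)
      (add_le_add (remaining_lubyDepth_le hN) le_rfl)).trans ?_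
    rw [← hX, ← ENNReal.ofReal_natCast, ← ENNReal.ofReal_ofNat, ← ENNReal.ofReal_add
      (by positivity) (by norm_num), ← ENNReal.ofReal_mul (by positivity)]
    refine ENNReal.ofReal_le_ofReal ?_
    have hcast : ((2000 * K * (D + 1) * B ^ (D + 1) : ℕ) : ℝ) = 2000 * K * X := by
      rw [hX]
      push_cast
      ring
    rw [hcast]
    push_cast
    have hK0 : (0 : ℝ) ≤ K := Nat.cast_nonneg K
    nlinarith

theorem runtime_bounds {T : SearchTask S} {h : S → ℕ∞} {B D K : ℕ} (hc : T.EHCComplete h)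
    (hsafe : T.SafeHeuristic h) (hB : ∀ s, (T.succ s).card ≤ B) (hD : T.maxExitDist h ≤ D)
    (hi : T.goal T.init ∨ h T.init ≤ K ∧ 1 ≤ K) {T' : SearchTask S}
    (hT' : T' ∈ ({T, T.prune h} : Set (SearchTask S))) :
    (T.goal T.init → ∀ depth, T'.expectedRuntime h depth ≤ 3) ∧
    (¬ T.goal T.init →
      (∀ ℓ : ℕ, D + 1 ≤ ℓ → T'.expectedRuntime h (constDepth ℓ) ≤
        ((2000 * K * ℓ * B ^ (D + 1) : ℕ) : ℝ≥0∞)) ∧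
      T'.expectedRuntime h lubyDepth ≤
        ENNReal.ofReal (((2000 * K * (D + 1) * B ^ (D + 1) : ℕ) : ℝ) *
          (1 + Real.log (((D + 1) * B ^ (D + 1) : ℕ) : ℝ)))) := by
  have hE := escapesWithin_of_maxExitDist_le hD
  rcases hT' with rfl | rfl
  · exact ⟨fun hg depth => expectedRuntime_le_three h depth hg, fun hg =>
      have hi := hi.resolve_left hg
      ⟨fun ℓ hℓ => expectedRuntime_constDepth_le hB hE hg hi.1 hi.2 hℓ,
        expectedRuntime_lubyDepth_le hB hE hg hi.1 hi.2⟩⟩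
  · have hB' := fun s => (T.card_succ_prune_le h s).trans (hB s)
    have hE' := hE.prune hc hsafe
    exact ⟨fun hg depth => expectedRuntime_le_three h depth hg, fun hg =>
      have hi := hi.resolve_left hg
      ⟨fun ℓ hℓ => expectedRuntime_constDepth_le hB' hE' hg hi.1 hi.2 hℓ,
        expectedRuntime_lubyDepth_le hB' hE' hg hi.1 hi.2⟩⟩

end SearchTask

/-! ### STRIPS -/

namespace StripsProblem

variable (P : StripsProblem.{u})

open Classical in
lemma card_succ_task_le (s : P.State) : (P.task.succ s).card ≤ P.ops.card := by
  have hsub : (P.task.succ s).image Subtype.val ⊆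
      P.ops.image fun o => (s.1 \ o.del) ∪ o.add := by
    intro t ht
    obtain ⟨t', ht', rfl⟩ := Finset.mem_image.1 ht
    obtain ⟨o, ho, -, h⟩ := (Finset.mem_filter.1 ht').2
    exact Finset.mem_image.2 ⟨o, ho, h.symm⟩
  have hcard : ((P.task.succ s).image Subtype.val).card = (P.task.succ s).card :=
    Finset.card_image_of_injective _ Subtype.val_injective
  rw [← hcard]
  exact (Finset.card_le_card hsub).trans Finset.card_image_le

variable {P}

open Classical in
lemma IsRelaxedPlan.mono : ∀ {π : List (Operator P.Fact)} {s s' : Finset P.Fact},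
    P.IsRelaxedPlan s π → s ⊆ s' → P.IsRelaxedPlan s' π
  | [], _, _, h, hs => h.trans hs
  | _ :: _, _, _, h, hs =>
    ⟨h.1, h.2.1.trans hs, IsRelaxedPlan.mono h.2.2 (Finset.union_subset_union_left hs)⟩

open Classical in
lemma exists_isRelaxedPlan_of_hasPath : ∀ {k : ℕ} {s t : P.State},
    P.task.HasPath k s t → P.task.goal t → ∃ π, P.IsRelaxedPlan s.1 π
  | 0, s, t, h, ht => by
    obtain rfl : s = t := h
    exact ⟨[], ht⟩
  | k + 1, s, t, ⟨v, hv, h⟩, ht => by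
    obtain ⟨π, hπ⟩ := exists_isRelaxedPlan_of_hasPath h ht
    obtain ⟨o, ho, hpre, hvs⟩ := (Finset.mem_filter.1 hv).2
    refine ⟨o :: π, ho, hpre, hπ.mono ?_⟩
    rw [hvs]
    exact Finset.union_subset_union_left Finset.sdiff_subset

lemma hPlus_le {s : P.State} {π : List (Operator P.Fact)} (h : P.IsRelaxedPlan s.1 π) :
    P.hPlus s ≤ π.length :=
  iInf₂_le π h

/-- A real plan remains a plan when deletes are ignored, since the relaxed states only gain facts.
-/
lemma safeHeuristic_hPlus : P.task.SafeHeuristic P.hPlus := by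
  intro s hs k t hk ht
  obtain ⟨π, hπ⟩ := exists_isRelaxedPlan_of_hasPath hk ht
  exact absurd (hs ▸ hPlus_le hπ) (by simp)

lemma exists_isRelaxedPlan_of_ne_top {s : P.State} (hs : P.hPlus s ≠ ⊤) :
    ∃ π, P.IsRelaxedPlan s.1 π := by
  have h := lt_top_iff_ne_top.2 hs
  unfold hPlus at h
  simp only [iInf_lt_iff] at h
  obtain ⟨π, hπ, -⟩ := h
  exact ⟨π, hπ⟩

open Classical in
/-- Operators whose effects hold already can be removed from a relaxed plan. -/
lemma exists_isRelaxedPlan_length_le : ∀ (π : List (Operator P.Fact)) (s : Finset P.Fact),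
    P.IsRelaxedPlan s π →
      ∃ π', P.IsRelaxedPlan s π' ∧ π'.length ≤ (P.ops.filter fun o => ¬ o.add ⊆ s).card
  | [], _, h => ⟨[], h, Nat.zero_le _⟩
  | o :: π, s, h => by
    obtain ⟨ho, hpre, h⟩ := h
    obtain ⟨π', hπ', hlen⟩ := exists_isRelaxedPlan_length_le π _ h
    by_cases hadd : o.add ⊆ s
    · rw [Finset.union_eq_left.2 hadd] at hπ' hlen
      exact ⟨π', hπ', hlen⟩
    · refine ⟨o :: π', ⟨ho, hpre, hπ'⟩, ?_⟩
      rw [List.length_cons, Nat.succ_le_iff]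
      -- Once `o` is applied its add effects hold, so `o` itself leaves the set of operators still
      -- counted.
      refine hlen.trans_lt (Finset.card_lt_card ((Finset.ssubset_iff_of_subset ?_).2
        ⟨o, by simp [ho, hadd], by simp⟩))
      refine Finset.monotone_filter_right _ fun o' _ h1 h2 => ?_
      exact h1 (h2.trans Finset.subset_union_left)

lemma hPlus_le_card {s : P.State} (hs : P.hPlus s ≠ ⊤) : P.hPlus s ≤ P.ops.card := by
  classical
  obtain ⟨π, hπ⟩ := exists_isRelaxedPlan_of_ne_top hs
  obtain ⟨π', hπ', hlen⟩ := exists_isRelaxedPlan_length_le π _ hπ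
  refine (hPlus_le hπ').trans ?_
  exact_mod_cast hlen.trans (Finset.card_filter_le _ _)

lemma one_le_card_ops {s : P.State} (hg : ¬ P.task.goal s) (hs : P.hPlus s ≠ ⊤) :
    1 ≤ P.ops.card := by
  obtain ⟨_ | ⟨o, π⟩, hπ⟩ := exists_isRelaxedPlan_of_ne_top hs
  · exact absurd hπ hg
  · exact Finset.card_pos.2 ⟨o, hπ.1⟩

end StripsProblem

end EHCRRW

/-! ### The main theorem -/

theorem mainTheorem6 :
    ∃ C : ℕ,
      (∀ (S : Type u) [Fintype S] (T : SearchTask S) (h : S → ℕ∞),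
        T.SafeHeuristic h → T.EHCComplete h → ∀ H : ℕ, h T.init = H →
        ∃ D : ℕ, T.maxExitDist h = D ∧
          ∀ T' ∈ ({T, T.prune h} : Set (SearchTask S)),
            (∀ ℓ : ℕ, D + 1 ≤ ℓ → T'.expectedRuntime h (constDepth ℓ) < ⊤) ∧
            T'.expectedRuntime h lubyDepth < ⊤ ∧
            (¬ T.goal T.init →
              (∀ ℓ : ℕ, D + 1 ≤ ℓ →
                T'.expectedRuntime h (constDepth ℓ) ≤
                  ((C * max H 1 * ℓ * T.branching ^ (D + 1) : ℕ) : ℝ≥0∞)) ∧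
              T'.expectedRuntime h lubyDepth ≤
                ENNReal.ofReal (((C * max H 1 * (D + 1) * T.branching ^ (D + 1) : ℕ) : ℝ) *
                  (1 + Real.log (((D + 1) * T.branching ^ (D + 1) : ℕ) : ℝ))))) ∧
      (∀ D : ℕ, ∃ p : Polynomial ℕ,
        ∀ 𝒟 : Set StripsProblem.{v}, IsBoundedUHRDomain 𝒟 D →
        ∀ P ∈ 𝒟, P.hPlus P.task.init ≠ ⊤ →
        ∀ T' ∈ ({P.task, P.task.prune P.hPlus} : Set (SearchTask P.State)),
          (∀ ℓ : ℕ, D + 1 ≤ ℓ →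
            T'.expectedRuntime P.hPlus (constDepth ℓ) ≤ ((ℓ * p.eval P.ops.card : ℕ) : ℝ≥0∞)) ∧
          T'.expectedRuntime P.hPlus lubyDepth ≤ ((p.eval P.ops.card : ℕ) : ℝ≥0∞) ∧
          (¬ P.task.goal P.task.init →
            (∀ ℓ : ℕ, D + 1 ≤ ℓ →
              T'.expectedRuntime P.hPlus (constDepth ℓ) ≤
                ((C * P.ops.card * ℓ * P.ops.card ^ (D + 1) : ℕ) : ℝ≥0∞)) ∧
            T'.expectedRuntime P.hPlus lubyDepth ≤
              ENNReal.ofReal (((C * P.ops.card * (D + 1) * P.ops.card ^ (D + 1) : ℕ) : ℝ) *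
                (1 + Real.log (((D + 1) * P.ops.card ^ (D + 1) : ℕ) : ℝ))))) := by
  refine ⟨2000, ?_, ?_⟩
  · intro S _ T h hsafe hc H hH
    obtain ⟨D, hD⟩ := ENat.ne_top_iff_exists.1 (SearchTask.maxExitDist_ne_top hc hsafe)
    refine ⟨D, hD.symm, fun T' hT' => ?_⟩
    have hi : h T.init ≤ (max H 1 : ℕ) ∧ 1 ≤ max H 1 := by
      refine ⟨?_, le_max_right _ _⟩
      rw [hH]
      exact_mod_cast le_max_left _ _
    obtain ⟨h1, h2⟩ := SearchTask.runtime_bounds (B := T.branching) hc hsafe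
      (fun s => Finset.le_sup (f := fun s => (T.succ s).card) (Finset.mem_univ s)) hD.ge
      (Or.inr hi) hT'
    by_cases hg : T.goal T.init
    · exact ⟨fun ℓ _ => (h1 hg _).trans_lt (by norm_num), (h1 hg _).trans_lt (by norm_num),
        fun hg' => absurd hg hg'⟩
    · exact ⟨fun ℓ hℓ => ((h2 hg).1 ℓ hℓ).trans_lt (ENNReal.natCast_lt_top _),
        (h2 hg).2.trans_lt ENNReal.ofReal_lt_top, h2⟩
  · intro D
    -- The squares come from `1 + log Y ≤ Y` with `Y = (D + 1) * |O| ^ (D + 1)`, where `|O|` is the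
    -- number of operators; the constant 3 covers an initial state that is already a goal.
    refine ⟨Polynomial.C 2000 * Polynomial.X * Polynomial.C ((D + 1) ^ 2) *
      (Polynomial.X ^ (D + 1)) ^ 2 + Polynomial.C 3, fun 𝒟 h𝒟 P hP hinit T' hT' => ?_⟩
    obtain ⟨hc, hD⟩ := h𝒟 P hP
    have hi : P.task.goal P.task.init ∨
        P.hPlus P.task.init ≤ P.ops.card ∧ 1 ≤ P.ops.card := by
      by_cases hg : P.task.goal P.task.init
      · exact Or.inl hg
      · exact Or.inr ⟨StripsProblem.hPlus_le_card hinit,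
          StripsProblem.one_le_card_ops hg hinit⟩
    obtain ⟨h1, h2⟩ := SearchTask.runtime_bounds (B := P.ops.card) hc
      StripsProblem.safeHeuristic_hPlus P.card_succ_task_le hD hi hT'
    simp only [Polynomial.eval_add, Polynomial.eval_mul, Polynomial.eval_C, Polynomial.eval_X,
      Polynomial.eval_pow]
    refine ⟨fun ℓ hℓ => ?_, ?_, h2⟩
    · by_cases hg : P.task.goal P.task.init
      · refine (h1 hg _).trans ?_
        have : 3 ≤ ℓ * (2000 * P.ops.card * (D + 1) ^ 2 * (P.ops.card ^ (D + 1)) ^ 2 + 3) := by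
          nlinarith [Nat.zero_le (2000 * P.ops.card * (D + 1) ^ 2 * (P.ops.card ^ (D + 1)) ^ 2)]
        exact_mod_cast this
      · refine ((h2 hg).1 ℓ hℓ).trans (Nat.cast_le.2 ?_)
        have hN : 1 ≤ P.ops.card ^ (D + 1) := Nat.one_le_pow _ _ (hi.resolve_left hg).2
        calc 2000 * P.ops.card * ℓ * P.ops.card ^ (D + 1)
            = ℓ * (2000 * P.ops.card * 1 * P.ops.card ^ (D + 1)) := by ring
          _ ≤ ℓ * (2000 * P.ops.card * (D + 1) ^ 2 * (P.ops.card ^ (D + 1)) ^ 2 + 3) := by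
            gcongr ℓ * ?_
            refine le_add_right ?_
            gcongr 2000 * P.ops.card * ?_ * ?_
            · exact Nat.one_le_pow _ _ (by omega)
            · exact Nat.le_self_pow (by norm_num) _
    · by_cases hg : P.task.goal P.task.init
      · refine (h1 hg _).trans ?_
        have : 3 ≤ 2000 * P.ops.card * (D + 1) ^ 2 * (P.ops.card ^ (D + 1)) ^ 2 + 3 := by omega
        exact_mod_cast this
      · refine (h2 hg).2.trans ?_
        have hN : 1 ≤ P.ops.card ^ (D + 1) := Nat.one_le_pow _ _ (hi.resolve_left hg).2
        have hX : (0 : ℝ) < (((D + 1) * P.ops.card ^ (D + 1) : ℕ) : ℝ) := by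
          have : 0 < (D + 1) * P.ops.card ^ (D + 1) := Nat.mul_pos (by omega) hN
          exact_mod_cast this
        have hlog := Real.log_le_sub_one_of_pos hX
        rw [← ENNReal.ofReal_natCast]
        refine ENNReal.ofReal_le_ofReal ?_
        calc _ ≤ ((2000 * P.ops.card * (D + 1) * P.ops.card ^ (D + 1) : ℕ) : ℝ) *
              (((D + 1) * P.ops.card ^ (D + 1) : ℕ) : ℝ) := by
              gcongr
              linarith
          _ ≤ _ := by
              push_cast
              nlinarith
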